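/- Let $d\ge 1$ and $m\ge 0$ be integers. For $N\ge 0$ let $\Pi^d_{N,\max}$ denote the space of polynomials with complex coefficients in $d$ real variables whose degree in each variable separately is at most $N$. A set $W\subseteq\mathbb{R}^d$ is called a correct interpolation set for $\Pi^d_{N,\max}$ if for every function $g:W\to\mathbb{C}$ there is exactly one $P\in\Pi^d_{N,\max}$ with $P(x)=g(x)$ for all $x\in W$. For $h\in\mathbb{R}^d$ and $f:\mathbb{R}^d\to\mathbb{R}$ put $\Delta_hf(x)=f(x+h)-f(x)$, let $\Delta_h^{n}$ be the $n$-th iterate of $\Delta_h$, and let $e_1,\dots,e_d$ be the canonical basis of $\mathbb{R}^d$. Let $\theta=(\theta_1,\dots,\theta_d)\in\mathbb{R}^d$ be such that the subgroup $\mathbb{Z}^d+\theta\,\mathbb{Z}$ is dense in $\mathbb{R}^d$. Let $f:\mathbb{R}^d\to\mathbb{R}$ be any function (no global continuity is assumed) such that, for all $x\in\mathbb{R}^d$, $$\Delta_{e_k}^{m+1}f(x)=0\quad(k=1,\dots,d)\qquad\text{and}\qquad \Delta_{\theta}^{m+1}f(x)=0 .$$ If there is a correct interpolation set $W\subseteq\mathbb{R}^d$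 for $\Pi^d_{dm,\max}$ such that $f$ is continuous at every point of $W$, then $f\in\Pi^d_{m,\max}$, that is, there is $P\in\Pi^d_{m,\max}$ with $f(x)=P(x)$ for all $x\in\mathbb{R}^d$. -/

import Mathlib

noncomputable section

/-- The space of complex polynomials in `d` real variables whose degree in each variable
separately is at most `m`. -/
abbrev PiMax (d m : ℕ) : Submodule ℂ (MvPolynomial (Fin d) ℂ) :=
  MvPolynomial.restrictDegree (Fin d) ℂ m

/-- The value of a complex polynomial at a real point. -/
def polyVal {d : ℕ} (P : MvPolynomial (Fin d) ℂ) (x : EuclideanSpace ℝ (Fin d)) : ℂ :=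
  MvPolynomial.eval (fun i => (x i : ℂ)) P

/-- `W` is a correct interpolation set for the space `L` of polynomials: every complex-valued
function on `W` is interpolated by exactly one element of `L`. -/
def IsCorrectInterpolationSet {d : ℕ} (L : Submodule ℂ (MvPolynomial (Fin d) ℂ))
    (W : Set (EuclideanSpace ℝ (Fin d))) : Prop :=
  ∀ g : W → ℂ, ∃! P : MvPolynomial (Fin d) ℂ, P ∈ L ∧ ∀ x : W, polyVal P x = g x

/-- The additive group of all `n + k • θ` with `n` an integer vector and `k` an integer. -/
def integerSpan {d : ℕ} (θ : EuclideanSpace ℝ (Fin d)) :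
    AddSubgroup (EuclideanSpace ℝ (Fin d)) where
  carrier := {x | ∃ (n : Fin d → ℤ) (k : ℤ), ∀ i, x i = (n i : ℝ) + (k : ℝ) * θ i}
  zero_mem' := ⟨0, 0, fun i => by simp⟩
  add_mem' := by
    rintro x y ⟨n, k, hx⟩ ⟨n', k', hy⟩
    refine ⟨n + n', k + k', fun i => ?_⟩
    simp only [PiLp.add_apply, hx, hy, Pi.add_apply, Int.cast_add]
    ring
  neg_mem' := by
    rintro x ⟨n, k, hx⟩
    refine ⟨-n, -k, fun i => ?_⟩
    simp only [PiLp.neg_apply, hx, Pi.neg_apply, Int.cast_neg]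
    ring

end

open Filter Topology

/-! ### Newton's formula at integer multiples of a step -/

section Newton

variable {M : Type*} [AddCommGroup M]

/-! On each coset of the group generated by the `e_k` and `θ`, Newton's formula makes `f` a
polynomial in the integer coordinates `(n, t)`. Substituting `n_i = y_i - a_i - t θ_i` turns it into
`Q(y, t)`, of degree at most `m` in each `y_i` (`exists_coeffDegreeLE_of_fwdDiff`). By density,
coset points approach each `w ∈ W` with `|t| → ∞`, while continuity keeps the values convergent. So
if `Q` depended on `t`, its leading coefficient in `t` would vanish on `W`
(`polyVal_leadingCoeff_eq_zero`), hence identically by unique interpolation. Thus `f` is a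
polynomial on each coset, equal to `f` on `W` by continuity. Uniqueness again gives the same
polynomial for all cosets. -/

lemma fwdDiff_commute (h h' : M) :
    Function.Commute (fwdDiff h : (M → ℂ) → M → ℂ) (fwdDiff h') := by
  intro g
  funext y
  simp only [fwdDiff, add_right_comm y h h']
  ring

lemma fwdDiff_iter_eq_zero_of_commute {h h' : M} {N : ℕ} {g : M → ℂ}
    (hg : (fwdDiff h)^[N] g = 0) (j : ℕ) : (fwdDiff h)^[N] ((fwdDiff h')^[j] g) = 0 := by
  rw [((fwdDiff_commute h h').iterate_iterate N j).eq, hg]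
  exact Function.iterate_fixed (by funext; simp [fwdDiff]) j

/-- Newton's forward difference formula at integer multiples of the step, for a function whose
`N`-th difference vanishes. -/
lemma eq_sum_choose_mul_fwdDiff (h : M) (N : ℕ) : ∀ g : M → ℂ, (fwdDiff h)^[N] g = 0 →
    ∀ (y : M) (n : ℤ),
      g (y + n • h) = ∑ j ∈ Finset.range N, Ring.choose (n : ℂ) j * (fwdDiff h)^[j] g y := by
  induction N with
  | zero => intro g hg y n; simpa using congrFun hg (y + n • h)
  | succ N ih =>
    intro g hg y n
    have key := ih (fwdDiff h g) hg y
    have step (n : ℤ) : g (y + (n + 1) • h) - g (y + n • h) =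
        ∑ j ∈ Finset.range N, Ring.choose (n : ℂ) j * (fwdDiff h)^[j + 1] g y := by
      rw [add_smul, one_smul, ← add_assoc]
      exact key n
    -- By Pascal's rule both sides have the same increments in `n`, so induction runs both ways from
    -- `0`.
    have step' (n : ℤ) : (∑ j ∈ Finset.range (N + 1),
          Ring.choose ((n + 1 : ℤ) : ℂ) j * (fwdDiff h)^[j] g y) -
        ∑ j ∈ Finset.range (N + 1), Ring.choose (n : ℂ) j * (fwdDiff h)^[j] g y =
        ∑ j ∈ Finset.range N, Ring.choose (n : ℂ) j * (fwdDiff h)^[j + 1] g y := by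
      rw [Finset.sum_range_succ', Finset.sum_range_succ']
      push_cast
      simp only [Ring.choose_succ_succ, Ring.choose_zero_right, add_mul, Finset.sum_add_distrib]
      ring
    induction n using Int.induction_on with
    | zero =>
      rw [Finset.sum_range_succ']
      simp [Ring.choose_zero_succ]
    | succ n hn => linear_combination hn + step n - step' n
    | pred n hn =>
      have h1 := step (-n - 1)
      have h2 := step' (-n - 1)
      rw [sub_add_cancel] at h1 h2
      linear_combination hn - h1 + h2

end Newton

/-- The polynomial `t ↦ t choose j`. -/
lemma exists_polynomial_eval_eq_choose (j : ℕ) :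
    ∃ b : Polynomial ℂ, b.natDegree ≤ j ∧ ∀ t, b.eval t = Ring.choose t j := by
  refine ⟨Polynomial.C ((j.factorial : ℂ)⁻¹) * (descPochhammer ℤ j).map (Int.castRingHom ℂ), ?_, ?_⟩
  · refine (Polynomial.natDegree_C_mul_le _ _).trans
      (Polynomial.natDegree_map_le.trans (descPochhammer_natDegree ℤ j).le)
  · intro t
    rw [Ring.choose_eq_smul, Polynomial.eval_mul, Polynomial.eval_C, smul_eq_mul,
      ← Polynomial.eval₂_eq_eval_map, ← Polynomial.eval₂_smulOneHom_eq_smeval]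
    congr 2
    exact RingHom.ext_int _ _

/-! ### Degree bounds for polynomials in `t` with polynomial coefficients -/

section CoeffDegree

variable {d : ℕ}

/-- The coefficients of `Q` have degree at most `D i` in the variable `i`. -/
def CoeffDegreeLE (D : Fin d → ℕ) (Q : Polynomial (MvPolynomial (Fin d) ℂ)) : Prop :=
  ∀ n i, (Q.coeff n).degreeOf i ≤ D i

lemma CoeffDegreeLE.mono {D D' : Fin d → ℕ} {Q : Polynomial (MvPolynomial (Fin d) ℂ)}
    (hQ : CoeffDegreeLE D Q) (h : D ≤ D') : CoeffDegreeLE D' Q :=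
  fun n i => (hQ n i).trans (h i)

lemma CoeffDegreeLE.sum {ι : Type*} {D : Fin d → ℕ} (s : Finset ι)
    {Q : ι → Polynomial (MvPolynomial (Fin d) ℂ)} (hQ : ∀ j ∈ s, CoeffDegreeLE D (Q j)) :
    CoeffDegreeLE D (∑ j ∈ s, Q j) := fun n i => by
  rw [Polynomial.finsetSum_coeff]
  exact (MvPolynomial.degreeOf_sum_le i s _).trans (Finset.sup_le fun j hj => hQ j hj n i)

lemma CoeffDegreeLE.mul {D D' : Fin d → ℕ} {Q Q' : Polynomial (MvPolynomial (Fin d) ℂ)}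
    (hQ : CoeffDegreeLE D Q) (hQ' : CoeffDegreeLE D' Q') :
    CoeffDegreeLE (D + D') (Q * Q') := fun n i => by
  rw [Polynomial.coeff_mul]
  refine (MvPolynomial.degreeOf_sum_le i _ _).trans (Finset.sup_le fun p _ => ?_)
  exact (MvPolynomial.degreeOf_mul_le i _ _).trans (add_le_add (hQ _ i) (hQ' _ i))

lemma CoeffDegreeLE.map_C (p : Polynomial ℂ) :
    CoeffDegreeLE (0 : Fin d → ℕ) (p.map MvPolynomial.C) := fun n i => by
  simp [Polynomial.coeff_map, MvPolynomial.degreeOf_C]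

lemma CoeffDegreeLE.pow {D : Fin d → ℕ} {Q : Polynomial (MvPolynomial (Fin d) ℂ)}
    (hQ : CoeffDegreeLE D Q) (j : ℕ) : CoeffDegreeLE (j • D) (Q ^ j) := by
  induction j with
  | zero => simpa using CoeffDegreeLE.map_C (d := d) 1
  | succ j ih => rw [pow_succ, succ_nsmul]; exact ih.mul hQ

lemma CoeffDegreeLE.aeval {D : Fin d → ℕ} {Q : Polynomial (MvPolynomial (Fin d) ℂ)}
    (hQ : CoeffDegreeLE D Q) (p : Polynomial ℂ) :
    CoeffDegreeLE (p.natDegree • D) (Polynomial.aeval Q p) := by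
  rw [Polynomial.aeval_eq_sum_range]
  refine CoeffDegreeLE.sum _ fun j hj => ?_
  have h := ((CoeffDegreeLE.map_C (d := d) (Polynomial.C (p.coeff j))).mul (hQ.pow j)).mono
    (D' := p.natDegree • D) (by
      rw [zero_add]
      exact nsmul_le_nsmul_left (fun _ => Nat.zero_le _)
        (Nat.lt_succ_iff.mp (Finset.mem_range.mp hj)))
  convert h using 1
  rw [Polynomial.map_C, ← Polynomial.smul_eq_C_mul, MvPolynomial.C_eq_smul_one, smul_one_smul]

/-- Evaluation of a polynomial with polynomial coefficients. -/
noncomputable def evalBoth (x : Fin d → ℂ) (t : ℂ) : Polynomial (MvPolynomial (Fin d) ℂ) →+* ℂ :=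
  Polynomial.eval₂RingHom (MvPolynomial.eval x) t

lemma evalBoth_eq_sum (x : Fin d → ℂ) (t : ℂ) (Q : Polynomial (MvPolynomial (Fin d) ℂ)) :
    evalBoth x t Q =
      ∑ i ∈ Finset.range (Q.natDegree + 1), MvPolynomial.eval x (Q.coeff i) * t ^ i :=
  Polynomial.eval₂_eq_sum_range _ _

lemma evalBoth_aeval (x : Fin d → ℂ) (t : ℂ) (Q : Polynomial (MvPolynomial (Fin d) ℂ))
    (p : Polynomial ℂ) : evalBoth x t (Polynomial.aeval Q p) = p.eval (evalBoth x t Q) := by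
  rw [Polynomial.aeval_eq_sum_range, Polynomial.eval_eq_sum_range, map_sum]
  refine Finset.sum_congr rfl fun j _ => ?_
  rw [Algebra.smul_def, map_mul, map_pow]
  congr 1
  simp [evalBoth]

lemma evalBoth_map_C (x : Fin d → ℂ) (t : ℂ) (p : Polynomial ℂ) :
    evalBoth x t (p.map MvPolynomial.C) = p.eval t := by
  simp only [evalBoth, Polynomial.coe_eval₂RingHom, Polynomial.eval₂_map, Polynomial.eval]
  congr 1
  ext
  simp

end CoeffDegree

/-! ### Polynomial form on a coset -/

variable {d : ℕ}

/-- On the translates of the lattice spanned by the basis vectors in `s`, a function annihilated by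
the corresponding differences is a polynomial in `x - t θ`. -/
lemma exists_coeffDegreeLE_of_fwdDiff_single (a θ : EuclideanSpace ℝ (Fin d)) (m : ℕ)
    (s : Finset (Fin d)) : ∀ g : EuclideanSpace ℝ (Fin d) → ℂ,
    (∀ k ∈ s, (fwdDiff (EuclideanSpace.single k (1 : ℝ)))^[m + 1] g = 0) →
    ∃ Q, CoeffDegreeLE (fun i => if i ∈ s then m else 0) Q ∧
      ∀ (n : Fin d → ℤ) (t : ℂ) (x : Fin d → ℂ), (∀ i, x i = a i + n i + t * θ i) →
        g (a + ∑ i ∈ s, n i • EuclideanSpace.single i (1 : ℝ)) = evalBoth x t Q := by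
  induction s using Finset.induction_on with
  | empty =>
    intro g _
    refine ⟨(Polynomial.C (g a)).map MvPolynomial.C, (CoeffDegreeLE.map_C _).mono (by simp), ?_⟩
    intro n t x _
    rw [evalBoth_map_C]
    simp
  | insert k s hk ih =>
    intro g hg
    have hstep (j : ℕ) := ih ((fwdDiff (EuclideanSpace.single k (1 : ℝ)))^[j] g) fun k' hk' =>
      fwdDiff_iter_eq_zero_of_commute (hg k' (Finset.mem_insert_of_mem hk')) j
    choose Q hQ hgQ using hstep
    choose b hb hbe using exists_polynomial_eval_eq_choose
    -- `L` expresses the integer coordinate `n k` as `x k - a k - t θ k`.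
    let L : Polynomial (MvPolynomial (Fin d) ℂ) :=
      Polynomial.C (MvPolynomial.X k) +
        (-Polynomial.C (a k : ℂ) - Polynomial.C (θ k : ℂ) * Polynomial.X).map MvPolynomial.C
    have hL : CoeffDegreeLE (Pi.single k 1) L := fun n i => by
      rw [Polynomial.coeff_add]
      refine (MvPolynomial.degreeOf_add_le i _ _).trans (max_le ?_ ?_)
      · rw [Polynomial.coeff_C]
        split_ifs
        · rw [MvPolynomial.degreeOf_X, Pi.single_apply]
        · simp
      · exact (CoeffDegreeLE.map_C _ n i).trans (Nat.zero_le _)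
    refine ⟨∑ j ∈ Finset.range (m + 1), Polynomial.aeval L (b j) * Q j, ?_, ?_⟩
    -- As `k ∉ s`, `Q j` has degree 0 in variable `k`, and the factor in `L` involves no other
    -- variable, so the degrees do not add up.
    · refine CoeffDegreeLE.sum _ fun j hj => ((hL.aeval (b j)).mul (hQ j)).mono fun i => ?_
      have hj' := (hb j).trans (Nat.lt_succ_iff.mp (Finset.mem_range.mp hj))
      by_cases hik : i = k
      · subst hik
        simpa [hk] using hj'
      · simp [hik]
    · intro n t x hx
      rw [Finset.sum_insert hk, add_left_comm, add_comm, eq_sum_choose_mul_fwdDiff _ (m + 1) g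
        (hg k (Finset.mem_insert_self k s)), map_sum]
      refine Finset.sum_congr rfl fun j _ => ?_
      rw [map_mul, evalBoth_aeval, hbe, hgQ j n t x hx]
      congr 2
      simp only [L, map_add, evalBoth_map_C]
      simp [evalBoth, hx]
      ring

/-- On a coset of the group spanned by the basis vectors and `θ`, a function annihilated by the
differences in these directions is a polynomial in the position and the multiple of `θ`. -/
lemma exists_coeffDegreeLE_of_fwdDiff (a θ : EuclideanSpace ℝ (Fin d)) (m : ℕ)
    (g : EuclideanSpace ℝ (Fin d) → ℂ)
    (hg : ∀ k, (fwdDiff (EuclideanSpace.single k (1 : ℝ)))^[m + 1] g = 0)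
    (hgθ : (fwdDiff θ)^[m + 1] g = 0) :
    ∃ Q, CoeffDegreeLE (fun _ => m) Q ∧
      ∀ (y : EuclideanSpace ℝ (Fin d)) (n : Fin d → ℤ) (t : ℤ),
        (∀ i, y i = a i + n i + t * θ i) → g y = evalBoth (fun i => (y i : ℂ)) t Q := by
  choose Q hQ hgQ using fun j : ℕ => exists_coeffDegreeLE_of_fwdDiff_single a θ m Finset.univ
    ((fwdDiff θ)^[j] g) fun k _ => fwdDiff_iter_eq_zero_of_commute (hg k) j
  choose b hb hbe using exists_polynomial_eval_eq_choose
  refine ⟨∑ j ∈ Finset.range (m + 1), (b j).map MvPolynomial.C * Q j, ?_, ?_⟩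
  · refine CoeffDegreeLE.sum _ fun j _ => ((CoeffDegreeLE.map_C (b j)).mul (hQ j)).mono ?_
    intro i
    simp
  · intro y n t hy
    have hy' : y = a + ∑ i, n i • EuclideanSpace.single i (1 : ℝ) + t • θ := by
      ext i
      simp [hy, Finset.sum_apply, Pi.single_apply]
    conv_lhs => rw [hy']
    rw [eq_sum_choose_mul_fwdDiff _ (m + 1) g hgθ, map_sum]
    refine Finset.sum_congr rfl fun j _ => ?_
    rw [map_mul, evalBoth_map_C, hbe, hgQ j n t (fun i => (y i : ℂ)) fun i => by simp [hy]]

/-! ### Approaching a point along a coset -/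

/-- The point of `a + ℤ^d + ℤ θ` with given integer coordinates. -/
def latticePoint (a θ : EuclideanSpace ℝ (Fin d)) (p : (Fin d → ℤ) × ℤ) :
    EuclideanSpace ℝ (Fin d) :=
  WithLp.toLp 2 fun i => a i + p.1 i + p.2 * θ i

/-- The filter of integer coordinates leaving every finite set while the corresponding point of
`a + ℤ^d + ℤ θ` tends to `w`. -/
def latticeApproach (a θ w : EuclideanSpace ℝ (Fin d)) : Filter ((Fin d → ℤ) × ℤ) :=
  comap (latticePoint a θ) (𝓝 w) ⊓ cofinite

lemma tendsto_latticePoint (a θ w : EuclideanSpace ℝ (Fin d)) :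
    Tendsto (latticePoint a θ) (latticeApproach a θ w) (𝓝 w) :=
  tendsto_comap.mono_left inf_le_left

/-- For `d ≥ 1` there are no isolated points, so a dense set stays dense after removal of finitely
many points. -/
lemma latticeApproach_neBot [NeZero d] (a : EuclideanSpace ℝ (Fin d)) {θ : EuclideanSpace ℝ (Fin d)}
    (hθ : Dense (integerSpan θ : Set (EuclideanSpace ℝ (Fin d)))) (w : EuclideanSpace ℝ (Fin d)) :
    (latticeApproach a θ w).NeBot := by
  have : Nontrivial (EuclideanSpace ℝ (Fin d)) :=
    ⟨⟨EuclideanSpace.single 0 1, 0, by simp⟩⟩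
  have (v : EuclideanSpace ℝ (Fin d)) : (𝓝[≠] v).NeBot := Module.punctured_nhds_neBot ℝ _ v
  refine inf_neBot_iff.mpr fun {s} hs {t} ht => ?_
  obtain ⟨U, hU, hUs⟩ := mem_comap.mp hs
  have hU' : (fun v => v + a) ⁻¹' U ∈ 𝓝 (w - a) :=
    (continuous_add_const a).continuousAt.preimage_mem_nhds (by simpa using hU)
  have hfin : ((fun p => latticePoint a θ p - a) '' tᶜ).Finite := Set.Finite.image _ ht
  obtain ⟨v, hvU, ⟨n, k, hv⟩, hvt⟩ :=
    mem_closure_iff_nhds.mp ((hθ.sdiff_finite hfin).closure_eq ▸ Set.mem_univ (w - a)) _ hU'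
  have hpt : latticePoint a θ (n, k) = v + a := by
    ext i
    simp only [latticePoint, PiLp.add_apply, hv]
    ring
  refine ⟨(n, k), hUs ?_, ?_⟩
  · rw [Set.mem_preimage, hpt]
    exact hvU
  · by_contra hnt
    exact hvt ⟨(n, k), hnt, by simp [hpt]⟩

/-- For fixed `k` the points form a translate of `ℤ^d`, which meets a ball in a finite set. -/
lemma tendsto_snd_latticeApproach (a θ w : EuclideanSpace ℝ (Fin d)) :
    Tendsto Prod.snd (latticeApproach a θ w) cofinite := by
  refine le_cofinite_iff_eventually_ne.mpr fun k => eventually_map.mpr ?_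
  have hfin : {p : (Fin d → ℤ) × ℤ | p.2 = k ∧ latticePoint a θ p ∈ Metric.ball w 1}.Finite := by
    have hI (i : Fin d) : {z : ℤ | |(z : ℝ) + (a i + k * θ i - w i)| < 1}.Finite := by
      refine (Set.finite_Icc (⌊-1 - (a i + k * θ i - w i)⌋) (⌈1 - (a i + k * θ i - w i)⌉)).subset ?_
      intro z hz
      rw [Set.mem_ofPred_eq, abs_lt] at hz
      constructor
      · exact Int.cast_le.mp ((Int.floor_le (α := ℝ) _).trans (by linarith))
      · exact Int.cast_le.mp (le_trans (by linarith) (Int.le_ceil (α := ℝ) _))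
    refine ((Set.Finite.pi fun i => hI i).prod (Set.finite_singleton k)).subset ?_
    rintro ⟨n, k'⟩ ⟨hk, hp⟩
    obtain rfl : k' = k := hk
    refine ⟨fun i _ => ?_, rfl⟩
    rw [mem_ball_iff_norm] at hp
    have := (PiLp.norm_apply_le (latticePoint a θ (n, k') - w) i).trans_lt hp
    simp only [latticePoint, PiLp.sub_apply, Real.norm_eq_abs] at this
    rw [Set.mem_ofPred_eq]
    have e : (n i : ℝ) + (a i + k' * θ i - w i) = a i + n i + k' * θ i - w i := by ring
    rwa [e]
  have h1 : ∀ᶠ p in latticeApproach a θ w, latticePoint a θ p ∈ Metric.ball w 1 :=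
    tendsto_latticePoint a θ w (Metric.ball_mem_nhds w one_pos)
  have h2 := (inf_le_right : latticeApproach a θ w ≤ cofinite) hfin.compl_mem_cofinite
  filter_upwards [h1, h2] with p hp hp' hk
  exact hp' ⟨hk, hp⟩

lemma continuous_polyVal (P : MvPolynomial (Fin d) ℂ) : Continuous (polyVal P) := by
  have h := MvPolynomial.continuous_eval P
  exact h.comp (by fun_prop)

/-- If the values of `Q` at `(x, k)` stay convergent while `x` tends to `w` and `|k|` tends to
infinity, then the leading coefficient of a nonconstant `Q` vanishes at `w`. -/
lemma polyVal_leadingCoeff_eq_zero {α : Type*} {l : Filter α} [l.NeBot]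
    {x : α → EuclideanSpace ℝ (Fin d)} {k : α → ℤ} {w : EuclideanSpace ℝ (Fin d)} {c : ℂ}
    (hx : Tendsto x l (𝓝 w)) (hk : Tendsto k l cofinite)
    {Q : Polynomial (MvPolynomial (Fin d) ℂ)} (hQ : Q.natDegree ≠ 0)
    (h : Tendsto (fun p => evalBoth (fun i => (x p i : ℂ)) (k p) Q) l (𝓝 c)) :
    polyVal Q.leadingCoeff w = 0 := by
  have hu : Tendsto (fun p => ((k p : ℂ))⁻¹) l (𝓝 0) := by
    refine tendsto_inv₀_cobounded.comp ?_
    rw [tendsto_norm_atTop_iff_cobounded.symm]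
    have h1 : Tendsto (fun p => ‖(k p : ℝ)‖) l atTop :=
      tendsto_norm_cocompact_atTop.comp (Int.tendsto_coe_cofinite.comp hk)
    simpa using h1
  have hne : ∀ᶠ p in l, k p ≠ 0 := hk.eventually (Set.finite_singleton (0 : ℤ)).eventually_cofinite_notMem
  -- After division by `k ^ Q.natDegree` the convergent values tend to 0, whereas termwise only the
  -- leading coefficient survives.
  have h0 : Tendsto (fun p => evalBoth (fun i => (x p i : ℂ)) (k p) Q * ((k p : ℂ))⁻¹ ^ Q.natDegree)
      l (𝓝 0) := by
    simpa [zero_pow hQ] using h.mul (hu.pow Q.natDegree)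
  have h1 : Tendsto (fun p => ∑ i ∈ Finset.range (Q.natDegree + 1),
      polyVal (Q.coeff i) (x p) * ((k p : ℂ))⁻¹ ^ (Q.natDegree - i)) l
      (𝓝 (∑ i ∈ Finset.range (Q.natDegree + 1),
        polyVal (Q.coeff i) w * 0 ^ (Q.natDegree - i))) :=
    tendsto_finsetSum _ fun i _ =>
      (((continuous_polyVal _).tendsto w).comp hx).mul (hu.pow _)
  have hlim : ∑ i ∈ Finset.range (Q.natDegree + 1),
      polyVal (Q.coeff i) w * 0 ^ (Q.natDegree - i) = polyVal Q.leadingCoeff w := by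
    rw [Finset.sum_range_succ, Finset.sum_eq_zero]
    · simp
    · intro i hi
      rw [zero_pow (Nat.sub_ne_zero_of_lt (Finset.mem_range.mp hi)), mul_zero]
  rw [← hlim]
  refine tendsto_nhds_unique h1 (h0.congr' ?_)
  filter_upwards [hne] with p hp
  have hp' : (k p : ℂ) ≠ 0 := Int.cast_ne_zero.mpr hp
  rw [evalBoth_eq_sum, Finset.sum_mul]
  refine Finset.sum_congr rfl fun i hi => ?_
  have hi' : i ≤ Q.natDegree := Nat.lt_succ_iff.mp (Finset.mem_range.mp hi)
  rw [polyVal, mul_assoc]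
  congr 1
  rw [inv_pow, inv_pow, ← div_eq_mul_inv, div_eq_iff (pow_ne_zero _ hp'),
    ← Nat.sub_add_cancel hi', pow_add, Nat.add_sub_cancel]
  field_simp

lemma mem_PiMax_iff {N : ℕ} {P : MvPolynomial (Fin d) ℂ} :
    P ∈ PiMax d N ↔ ∀ i, P.degreeOf i ≤ N := by
  simp only [PiMax, MvPolynomial.mem_restrictDegree, MvPolynomial.degreeOf_le_iff]
  exact ⟨fun h i s hs => h s hs i, fun h s hs i => h i s hs⟩

theorem theorem3p5 (d m : ℕ) (θ : EuclideanSpace ℝ (Fin d))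
    (hθ : Dense (integerSpan θ : Set (EuclideanSpace ℝ (Fin d))))
    (f : EuclideanSpace ℝ (Fin d) → ℝ)
    (hf : ∀ k : Fin d, ∀ x : EuclideanSpace ℝ (Fin d),
      (fwdDiff (EuclideanSpace.single k (1 : ℝ)))^[m + 1] f x = 0)
    (hfθ : ∀ x : EuclideanSpace ℝ (Fin d), (fwdDiff θ)^[m + 1] f x = 0)
    (W : Set (EuclideanSpace ℝ (Fin d)))
    (hW : IsCorrectInterpolationSet (PiMax d (d * m)) W)
    (hcont : ∀ w ∈ W, ContinuousAt f w) :
    ∃ P ∈ PiMax d m, ∀ x : EuclideanSpace ℝ (Fin d), (f x : ℂ) = polyVal P x := by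
  rcases Nat.eq_zero_or_pos d with rfl | hd
  · refine ⟨MvPolynomial.C (f 0 : ℂ), mem_PiMax_iff.mpr fun i => i.elim0, fun x => ?_⟩
    simp [polyVal, Subsingleton.elim x 0]
  have : NeZero d := ⟨hd.ne'⟩
  have hsub {P : MvPolynomial (Fin d) ℂ} (hP : P ∈ PiMax d m) : P ∈ PiMax d (d * m) :=
    mem_PiMax_iff.mpr fun i => (mem_PiMax_iff.mp hP i).trans (Nat.le_mul_of_pos_left m hd)
  let g : EuclideanSpace ℝ (Fin d) → ℂ := fun x => (f x : ℂ)
  have hfg (h : EuclideanSpace ℝ (Fin d)) (hh : ∀ x, (fwdDiff h)^[m + 1] f x = 0) :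
      (fwdDiff h)^[m + 1] g = 0 := by
    funext x
    have := congrArg (fun r : ℝ => (r : ℂ)) (hh x)
    simp only [fwdDiff_iter_eq_sum_shift, zsmul_eq_mul] at this ⊢
    push_cast at this
    simpa [g] using this
  have hgcont (w) (hw : w ∈ W) : ContinuousAt g w :=
    Complex.continuous_ofReal.continuousAt.comp (hcont w hw)
  -- `P` may depend on `a` here; its values on `W` do not.
  have local_poly (a : EuclideanSpace ℝ (Fin d)) :
      ∃ P ∈ PiMax d m, g a = polyVal P a ∧ ∀ w ∈ W, polyVal P w = g w := by
    obtain ⟨Q, hQ, hgQ⟩ := exists_coeffDegreeLE_of_fwdDiff a θ m g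
      (fun k => hfg _ (hf k)) (hfg _ hfθ)
    have hlat (p) : g (latticePoint a θ p) =
        evalBoth (fun i => (latticePoint a θ p i : ℂ)) p.2 Q :=
      hgQ _ p.1 p.2 fun i => rfl
    have hmem (n) : Q.coeff n ∈ PiMax d m := mem_PiMax_iff.mpr (hQ n)
    have hlim (w) (hw : w ∈ W) :
        Tendsto (fun p => g (latticePoint a θ p)) (latticeApproach a θ w) (𝓝 (g w)) :=
      (hgcont w hw).tendsto.comp (tendsto_latticePoint a θ w)
    have hdeg : Q.natDegree = 0 := by
      by_contra hne
      have hvan (w) (hw : w ∈ W) : polyVal Q.leadingCoeff w = 0 := by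
        have := latticeApproach_neBot a hθ w
        refine polyVal_leadingCoeff_eq_zero (tendsto_latticePoint a θ w)
          (tendsto_snd_latticeApproach a θ w) hne (c := g w) ?_
        simpa only [hlat] using hlim w hw
      -- The leading coefficient and 0 both interpolate zero data on `W`.
      have h0 : Q.leadingCoeff = 0 := (hW 0).unique
        ⟨hsub (hmem _), fun w => hvan w w.2⟩ ⟨Submodule.zero_mem _, fun w => by simp [polyVal]⟩
      rw [Polynomial.leadingCoeff_eq_zero] at h0
      exact hne (by simp [h0])
    have hconst (y : EuclideanSpace ℝ (Fin d)) (t : ℂ) :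
        evalBoth (fun i => (y i : ℂ)) t Q = polyVal (Q.coeff 0) y := by
      simp [evalBoth_eq_sum, hdeg, polyVal]
    refine ⟨Q.coeff 0, hmem 0, ?_, fun w hw => ?_⟩
    · rw [← hconst a (0 : ℤ)]
      exact hgQ a 0 0 fun i => by simp
    · have := latticeApproach_neBot a hθ w
      refine tendsto_nhds_unique ?_ (hlim w hw)
      simp only [hlat, hconst]
      exact ((continuous_polyVal _).tendsto w).comp (tendsto_latticePoint a θ w)
  obtain ⟨P, hP, -, hPW⟩ := local_poly 0
  refine ⟨P, hP, fun x => ?_⟩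
  obtain ⟨P', hP', hx, hPW'⟩ := local_poly x
  rw [(hW fun w => g w).unique ⟨hsub hP, fun w => hPW w w.2⟩ ⟨hsub hP', fun w => hPW' w w.2⟩]
  exact hx
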